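/- For integers $k,\ell\ge 0$ let $D_{k,\ell}$ be the set of triples $(m,m',p)$ of integers with $m,m'\in\{1,\dots,k\}$, $m\ne m'$ and $p\in\{1,\dots,\ell\}$. Let $\mathrm{lk}^{QV}_\downarrow(x^ka^\ell)$ be the abstract simplicial complex with vertex set $D_{k,\ell}$ in which a non-empty set $\{(m_1,m_1',p_1),\dots,(m_\alpha,m_\alpha',p_\alpha)\}$ of $\alpha$ distinct vertices is a simplex if and only if there are no repetitions in the list $m_1,m_1',\dots,m_\alpha,m_\alpha'$ and no repetitions in the list $p_1,\dots,p_\alpha$. Let $\mathrm{lk}^{QF}_\downarrow(x^ka^\ell)$ and $\mathrm{lk}^{QT}_\downarrow(x^ka^\ell)$ be the full subcomplexes of $\mathrm{lk}^{QV}_\downarrow(x^ka^\ell)$ spanned by the vertex sets \[\{(m,m+1,p)\mid 1\le m\le k-1,\ 1\le p\le \ell\}\] and \[\{(m,m+1,p)\mid 1\le m\le k-1,\ 1\le p\le \ell\}\cup\{(k,1,p)\mid 1\le p\le \ell\},\] respectively. A space is called $n$-connected if it is non-empty and its homotopy groups (sets) $\pi_i$ are trivial for all $0\le i\le n$ and all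 base points; a simplicial complex is $n$-connected if its geometric realization is. Proposition. Let $n\ge 0$. If $k\ge 3n+5$ and $\ell\ge 2n+3$, then $\mathrm{lk}^{QF}_\downarrow(x^ka^\ell)$ and $\mathrm{lk}^{QT}_\downarrow(x^ka^\ell)$ are both $n$-connected. -/

import Mathlib

open scoped Topology

noncomputable section

namespace DescendingLinks

/-- The geometric realization of an abstract simplicial complex on a finite vertex type, in
barycentric coordinates: the union, over all simplices `s`, of the set of points of the standard
simplex on all vertices whose coordinates vanish outside `s`, with the Euclidean topology. -/
def realization {V : Type*} [Fintype V] (K : PreAbstractSimplicialComplex V) : Set (V → ℝ) :=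
  {w | w ∈ stdSimplex ℝ V ∧ ∃ s ∈ K.faces, ∀ v, v ∉ s → w v = 0}

/-- A space is `n`-connected (`n ≥ 0`) if it is non-empty and `π_i` is trivial for all `i ≤ n` and
all base points. For `i = 0` this is path-connectedness. -/
def IsNConnected (n : ℕ) (X : Type*) [TopologicalSpace X] : Prop :=
  Nonempty X ∧ ∀ i ≤ n, ∀ x : X, Subsingleton (π_ i X x)

/-- The (full) subcomplex of `K` spanned by a set `W` of vertices. -/
def spannedSubcomplex {V : Type*} (K : PreAbstractSimplicialComplex V) (W : Set V) :
    PreAbstractSimplicialComplex V where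
  faces := {s | s ∈ K.faces ∧ ∀ v ∈ s, v ∈ W}
  isRelLowerSet_faces := by
    rintro s ⟨hs, hW⟩
    refine ⟨(K.isRelLowerSet_faces hs).1, fun t hts ht => ⟨?_, fun v hv => hW v (hts hv)⟩⟩
    exact (K.isRelLowerSet_faces hs).2 hts ht

/-- The set `D_v` for `v = x^k a^ℓ`: triples `(m, n, p)` with `m, n ∈ {1, …, k}`, `m ≠ n` and
`p ∈ {1, …, ℓ}`. -/
def vertexSet (k l : ℕ) : Finset (ℕ × ℕ × ℕ) :=
  (Finset.Icc 1 k ×ˢ Finset.Icc 1 k ×ˢ Finset.Icc 1 l).filter fun t => t.1 ≠ t.2.1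

/-- The list `m₁, n₁, …, m_α, n_α` of the first two coordinates of the members
`(m_i, n_i, p_i)` of `S`. -/
def xCoords {k l : ℕ} (S : Finset (vertexSet k l)) : Multiset ℕ :=
  S.val.bind fun v => {v.1.1, v.1.2.1}

/-- The list `p₁, …, p_α` of the last coordinates of the members `(m_i, n_i, p_i)` of `S`. -/
def aCoords {k l : ℕ} (S : Finset (vertexSet k l)) : Multiset ℕ :=
  S.val.map fun v => v.1.2.2

/-- The descending link `lk_↓(x^k a^ℓ) = lk_↓^{QV}(x^k a^ℓ)`: a non-empty set of triples is a
simplex iff there are no repetitions in the list of the first two coordinates, and none in the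
list of the last coordinates. -/
def lkQV (k l : ℕ) : PreAbstractSimplicialComplex (vertexSet k l) where
  faces := {S | S.Nonempty ∧ (xCoords S).Nodup ∧ (aCoords S).Nodup}
  isRelLowerSet_faces := by
    rintro S ⟨hne, hx, ha⟩
    refine ⟨hne, fun T hTS hT => ⟨hT, ?_, ?_⟩⟩
    · refine Multiset.nodup_of_le ?_ hx
      obtain ⟨u, hu⟩ := Multiset.le_iff_exists_add.1 (Finset.val_le_iff.2 hTS)
      rw [xCoords, xCoords, hu, Multiset.add_bind]
      exact Multiset.le_add_right _ _
    · exact Multiset.nodup_of_le (Multiset.map_le_map (Finset.val_le_iff.2 hTS)) ha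

/-- `lk_↓^{QF}(x^k a^ℓ)`: the subcomplex of `lk_↓^{QV}(x^k a^ℓ)` spanned by the vertices
`(m, m + 1, p)`, where `1 ≤ m ≤ k - 1` and `1 ≤ p ≤ ℓ` (membership in `vertexSet` implies these
bounds). -/
def lkQF (k l : ℕ) : PreAbstractSimplicialComplex (vertexSet k l) :=
  spannedSubcomplex (lkQV k l) {v | v.1.2.1 = v.1.1 + 1}

/-- `lk_↓^{QT}(x^k a^ℓ)`: the subcomplex of `lk_↓^{QV}(x^k a^ℓ)` spanned by the vertices
`(m, m + 1, p)` and `(k, 1, p)`. -/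
def lkQT (k l : ℕ) : PreAbstractSimplicialComplex (vertexSet k l) :=
  spannedSubcomplex (lkQV k l) ({v | v.1.2.1 = v.1.1 + 1} ∪ {v | v.1.1 = k ∧ v.1.2.1 = 1})

end DescendingLinks

end

namespace DescendingLinks

open Set Metric

/-- `SphereExt N Y`: the set `Y` is non-empty, and for `d ≤ N` every continuous map from the
boundary of the cube `[-1, 1]^d` to `Y` extends to the cube; that is, `Y` is
`(N - 1)`-connected. -/
def SphereExt {W : Type*} [TopologicalSpace W] (N : ℕ) (Y : Set W) : Prop :=
  Y.Nonempty ∧ ∀ d ≤ N, ∀ f : (Fin d → ℝ) → W, ContinuousOn f (sphere 0 1) →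
    MapsTo f (sphere 0 1) Y → ∃ g : (Fin d → ℝ) → W, ContinuousOn g (closedBall 0 1) ∧
      MapsTo g (closedBall 0 1) Y ∧ EqOn g f (sphere 0 1)

/-- A closed `d`-cell `c` with boundary `b` which is the image of a cube under a map `φ` that has
a left inverse `ψ` defined on the whole space. -/
def IsCell {Z : Type*} [TopologicalSpace Z] (d : ℕ) (c b : Set Z) : Prop :=
  b ⊆ c ∧ ∃ (φ : (Fin d → ℝ) → Z) (ψ : Z → Fin d → ℝ), Continuous φ ∧ Continuous ψ ∧
    MapsTo φ (sphere 0 1) b ∧ MapsTo φ (closedBall 0 1) c ∧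
    MapsTo ψ b (sphere 0 1) ∧ MapsTo ψ c (closedBall 0 1) ∧ LeftInvOn φ ψ c

theorem IsCell.exists_extension {Z W : Type*} [TopologicalSpace Z] [TopologicalSpace W]
    {d N : ℕ} {c b : Set Z} {Y : Set W} (hc : IsCell d c b) (hY : SphereExt N Y) (hd : d ≤ N)
    (f : Z → W) (hf : ContinuousOn f b) (hfY : MapsTo f b Y) :
    ∃ g : Z → W, ContinuousOn g c ∧ MapsTo g c Y ∧ EqOn g f b := by
  obtain ⟨hbc, φ, ψ, hφ, hψ, h1, -, h3, h4, h5⟩ := hc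
  obtain ⟨g, hg, hgY, hgf⟩ := hY.2 d hd (f ∘ φ) (hf.comp hφ.continuousOn h1) (hfY.comp h1)
  refine ⟨g ∘ ψ, hg.comp hψ.continuousOn h4, hgY.comp h4, fun x hx => ?_⟩
  simp only [Function.comp_apply]
  rw [hgf (h3 hx), Function.comp_apply, h5 (hbc hx)]

theorem mem_closedBall_pi {d : ℕ} {u : Fin d → ℝ} :
    u ∈ closedBall (0 : Fin d → ℝ) 1 ↔ ∀ i, |u i| ≤ 1 := by
  rw [mem_closedBall_zero_iff, pi_norm_le_iff_of_nonneg zero_le_one]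
  simp [Real.norm_eq_abs]

theorem mem_sphere_pi {d : ℕ} {u : Fin d → ℝ} :
    u ∈ sphere (0 : Fin d → ℝ) 1 ↔ (∀ i, |u i| ≤ 1) ∧ ∃ i, |u i| = 1 := by
  have h2 : ‖u‖ < 1 ↔ ∀ i, |u i| < 1 := by
    rw [pi_norm_lt_iff zero_lt_one]; simp [Real.norm_eq_abs]
  rw [← mem_closedBall_pi, mem_closedBall_zero_iff, mem_sphere_zero_iff_norm]
  constructor
  · intro h
    refine ⟨h.le, ?_⟩
    by_contra! hne
    have : ∀ i, |u i| < 1 := fun i =>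
      lt_of_le_of_ne (mem_closedBall_pi.1 (mem_closedBall_zero_iff.2 h.le) i) (hne i)
    exact absurd (h2.2 this) (by simp [h])
  · rintro ⟨h, i, hi⟩
    refine le_antisymm h (not_lt.1 fun hlt => ?_)
    exact absurd (h2.1 hlt i) (by simp [hi])

/-- The product of a cell with the unit interval is a cell. -/
theorem IsCell.prod_Icc {Z : Type*} [TopologicalSpace Z] {d : ℕ} {c b : Set Z}
    (hc : IsCell d c b) :
    IsCell (d + 1) (c ×ˢ Icc (0 : ℝ) 1) (b ×ˢ Icc (0 : ℝ) 1 ∪ c ×ˢ {0, 1}) := by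
  obtain ⟨hbc, φ, ψ, hφ, hψ, h1, h2, h3, h4, h5⟩ := hc
  refine ⟨?_, fun u => (φ (Fin.tail u), (u 0 + 1) / 2), fun x => Fin.cons (2 * x.2 - 1) (ψ x.1),
    ?_, ?_, ?_, ?_, ?_, ?_, ?_⟩
  · refine union_subset (prod_mono hbc subset_rfl) (prod_mono subset_rfl ?_)
    rintro t (rfl | rfl) <;> simp
  · refine (hφ.comp ?_).prodMk (by fun_prop)
    exact continuous_pi fun i => continuous_apply _
  · refine continuous_pi fun i => ?_
    refine Fin.cases ?_ (fun j => ?_) i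
    · simp only [Fin.cons_zero]; fun_prop
    · simp only [Fin.cons_succ]; exact (continuous_apply j).comp (hψ.comp continuous_fst)
  · intro u hu
    obtain ⟨hu1, hu2⟩ := mem_sphere_pi.1 hu
    have hI : (u 0 + 1) / 2 ∈ Icc (0 : ℝ) 1 := by
      have := abs_le.1 (hu1 0); constructor <;> linarith
    have ht : Fin.tail u ∈ closedBall (0 : Fin d → ℝ) 1 := mem_closedBall_pi.2 fun i => hu1 i.succ
    obtain ⟨i, hi⟩ := hu2
    induction i using Fin.cases with
    | zero =>
      refine Or.inr ⟨h2 ht, ?_⟩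
      rcases (abs_eq zero_le_one).1 hi with h | h <;> simp [h]
    | succ j => exact Or.inl ⟨h1 (mem_sphere_pi.2 ⟨fun i => hu1 i.succ, j, hi⟩), hI⟩
  · intro u hu
    have hu1 := mem_closedBall_pi.1 hu
    refine ⟨h2 (mem_closedBall_pi.2 fun i => hu1 i.succ), ?_⟩
    have := abs_le.1 (hu1 0); constructor <;> dsimp only <;> linarith
  · rintro ⟨x, t⟩ (⟨hx, ht⟩ | ⟨hx, ht⟩)
    · obtain ⟨h31, j, h32⟩ := mem_sphere_pi.1 (h3 hx)
      refine mem_sphere_pi.2 ⟨fun i => ?_, j.succ, by simpa using h32⟩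
      refine Fin.cases ?_ (fun j => ?_) i
      · simp only [Fin.cons_zero, abs_le]
        obtain ⟨h6, h7⟩ := ht; constructor <;> dsimp only at * <;> linarith
      · simpa using h31 j
    · have h41 := mem_closedBall_pi.1 (h4 hx)
      have : |2 * t - 1| = 1 := by
        rcases ht with h | h <;> simp only at h <;> subst h <;> norm_num
      refine mem_sphere_pi.2 ⟨fun i => ?_, 0, by simpa using this⟩
      refine Fin.cases ?_ (fun j => ?_) i
      · simpa using this.le
      · simpa using h41 j
  · rintro ⟨x, t⟩ ⟨hx, ht⟩
    have h41 := mem_closedBall_pi.1 (h4 hx)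
    refine mem_closedBall_pi.2 fun i => ?_
    refine Fin.cases ?_ (fun j => ?_) i
    · simp only [Fin.cons_zero, abs_le]
      obtain ⟨h6, h7⟩ := ht; constructor <;> dsimp only at * <;> linarith
    · simpa using h41 j
  · rintro ⟨x, t⟩ ⟨hx, -⟩
    simp only [Fin.tail_cons, Fin.cons_zero]
    rw [h5 hx]; congr 1; ring

/-- `H` is a homotopy on `K`, inside `Y`, from `f` to the constant map `y`. -/
def IsNullhomotopyOn {Z W : Type*} [TopologicalSpace Z] [TopologicalSpace W] (f : Z → W) (y : W)
    (Y : Set W) (K : Set Z) (H : Z × ℝ → W) : Prop :=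
  ContinuousOn H (K ×ˢ Icc 0 1) ∧ MapsTo H (K ×ˢ Icc 0 1) Y ∧
    ∀ x ∈ K, H (x, 0) = f x ∧ H (x, 1) = y

theorem IsNullhomotopyOn.congr {Z W : Type*} [TopologicalSpace Z] [TopologicalSpace W]
    {f : Z → W} {y : W} {Y : Set W} {K : Set Z} {H H' : Z × ℝ → W}
    (h : IsNullhomotopyOn f y Y K H) (hH : EqOn H' H (K ×ˢ Icc 0 1)) :
    IsNullhomotopyOn f y Y K H' := by
  refine ⟨h.1.congr hH, h.2.1.congr hH.symm, fun x hx => ?_⟩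
  rw [hH ⟨hx, by simp⟩, hH ⟨hx, by simp⟩]
  exact h.2.2 x hx

theorem IsNullhomotopyOn.mono {Z W : Type*} [TopologicalSpace Z] [TopologicalSpace W]
    {f : Z → W} {y : W} {Y Y' : Set W} {K : Set Z} {H : Z × ℝ → W}
    (h : IsNullhomotopyOn f y Y K H) (hY : Y ⊆ Y') : IsNullhomotopyOn f y Y' K H :=
  ⟨h.1, h.2.1.mono_right hY, h.2.2⟩

open Classical in
theorem IsNullhomotopyOn.union {Z W : Type*} [TopologicalSpace Z] [TopologicalSpace W]
    {f : Z → W} {y : W} {Y : Set W} {K L : Set Z} {H H' : Z × ℝ → W} (hK : IsClosed K)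
    (hL : IsClosed L) (h : IsNullhomotopyOn f y Y K H) (h' : IsNullhomotopyOn f y Y L H')
    (hH : EqOn H H' ((K ∩ L) ×ˢ Icc 0 1)) :
    ∃ G, IsNullhomotopyOn f y Y (K ∪ L) G ∧ EqOn G H (K ×ˢ Icc 0 1) := by
  set G : Z × ℝ → W := fun x => if x.1 ∈ K then H x else H' x with hG
  have e1 : EqOn G H (K ×ˢ Icc 0 1) := fun x hx => if_pos hx.1
  have e2 : EqOn G H' (L ×ˢ Icc 0 1) := fun x hx => by
    by_cases hxK : x.1 ∈ K
    · exact (if_pos hxK).trans (hH ⟨⟨hxK, hx.1⟩, hx.2⟩)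
    · exact if_neg hxK
  obtain ⟨a1, a2, a3⟩ := h.congr e1
  obtain ⟨b1, b2, b3⟩ := h'.congr e2
  refine ⟨G, ⟨?_, ?_, ?_⟩, e1⟩
  · rw [union_prod]
    exact a1.union_of_isClosed b1 (hK.prod isClosed_Icc) (hL.prod isClosed_Icc)
  · rw [union_prod]
    exact a2.union b2
  · rintro x (hx | hx)
    exacts [a3 x hx, b3 x hx]

open Classical in
/-- A homotopy from `f` to a constant map extends over an additional cell. -/
theorem IsNullhomotopyOn.extend_cell {Z W : Type*} [TopologicalSpace Z] [T1Space Z]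
    [TopologicalSpace W] {f : Z → W} {y : W} {Y : Set W} {K c : Set Z} {H : Z × ℝ → W} {d N : ℕ}
    (hK : IsClosed K) (hc : IsClosed c) (hcell : IsCell d c (K ∩ c)) (hd : d + 1 ≤ N)
    (hY : SphereExt N Y) (hy : y ∈ Y) (hf : ContinuousOn f c) (hfY : MapsTo f c Y)
    (h : IsNullhomotopyOn f y Y K H) :
    ∃ G, IsNullhomotopyOn f y Y (K ∪ c) G ∧ EqOn G H (K ×ˢ Icc 0 1) := by
  set F : Z × ℝ → W := fun x => if x.1 ∈ K then H x else if x.2 = 0 then f x.1 else y with hF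
  have e1 : EqOn F H ((K ∩ c) ×ˢ Icc 0 1) := fun x hx => if_pos hx.1.1
  have e2 : EqOn F (fun x => f x.1) (c ×ˢ {0}) := by
    rintro ⟨x, t⟩ ⟨hx, ht⟩
    obtain rfl : t = 0 := ht
    by_cases hxK : x ∈ K
    · simp only [hF, hxK, if_true]; exact (h.2.2 x hxK).1
    · simp [hF, hxK]
  have e3 : EqOn F (fun _ => y) (c ×ˢ {1}) := by
    rintro ⟨x, t⟩ ⟨hx, ht⟩
    obtain rfl : t = 1 := ht
    by_cases hxK : x ∈ K
    · simp only [hF, hxK, if_true]; exact (h.2.2 x hxK).2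
    · simp [hF, hxK]
  have hsub : ((K ∩ c) ×ˢ Icc (0 : ℝ) 1) ⊆ K ×ˢ Icc 0 1 := prod_mono inter_subset_left subset_rfl
  have hset : (K ∩ c) ×ˢ Icc (0 : ℝ) 1 ∪ c ×ˢ {0, 1} =
      (K ∩ c) ×ˢ Icc (0 : ℝ) 1 ∪ (c ×ˢ {0} ∪ c ×ˢ {1}) := by
    rw [← prod_union]; rfl
  have c1 : ContinuousOn F ((K ∩ c) ×ˢ Icc 0 1) := (h.1.mono hsub).congr e1
  have c2 : ContinuousOn F (c ×ˢ {0}) :=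
    (hf.comp continuousOn_fst fun x hx => hx.1).congr e2
  have c3 : ContinuousOn F (c ×ˢ {1}) := continuousOn_const.congr e3
  obtain ⟨G, hG1, hG2, hG3⟩ := hcell.prod_Icc.exists_extension hY hd F (by
      rw [hset]
      refine c1.union_of_isClosed (c2.union_of_isClosed c3 ?_ ?_) ?_ ?_
      · exact hc.prod isClosed_singleton
      · exact hc.prod isClosed_singleton
      · exact (hK.inter hc).prod isClosed_Icc
      · exact (hc.prod isClosed_singleton).union (hc.prod isClosed_singleton)) (by
      rw [hset]
      refine MapsTo.union ((h.2.1.mono_left hsub).congr e1.symm) (MapsTo.union ?_ ?_)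
      · exact MapsTo.congr (fun x hx => hfY hx.1) e2.symm
      · exact MapsTo.congr (fun x hx => hy) e3.symm)
  refine IsNullhomotopyOn.union hK hc h (H' := G) ⟨hG1, hG2, fun x hx => ⟨?_, ?_⟩⟩ ?_
  · rw [hG3 (Or.inr ⟨hx, by simp⟩), e2 (show (x, (0 : ℝ)) ∈ c ×ˢ {0} from ⟨hx, rfl⟩)]
  · rw [hG3 (Or.inr ⟨hx, by simp⟩), e3 (show (x, (1 : ℝ)) ∈ c ×ˢ {1} from ⟨hx, rfl⟩)]
  · intro x hx
    rw [hG3 (Or.inl hx), e1 hx]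

/-- The code of the open cell of the integer grid that contains `x`: an even entry `2a` stands for
the coordinate `a`, an odd entry `2a + 1` for the open interval `(a, a + 1)`. -/
noncomputable def gridCode {d : ℕ} (x : Fin d → ℝ) : Fin d → ℤ := fun i => ⌊x i⌋ + ⌈x i⌉

/-- The cell with code `z'` lies in the closed cell with code `z`. -/
def GridFace {d : ℕ} (z' z : Fin d → ℤ) : Prop :=
  ∀ i, z i / 2 ≤ z' i / 2 ∧ (z' i + 1) / 2 ≤ (z i + 1) / 2

/-- The closed grid cell with code `z`. -/
def gridCell {d : ℕ} (z : Fin d → ℤ) : Set (Fin d → ℝ) := {x | GridFace (gridCode x) z}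

/-- The union of the open grid cells with codes in `K`. -/
def gridPolyhedron {d : ℕ} (K : Finset (Fin d → ℤ)) : Set (Fin d → ℝ) := {x | gridCode x ∈ K}

/-- The dimension of the grid cell with code `z`. -/
def gridDim {d : ℕ} (z : Fin d → ℤ) : ℕ := (Finset.univ.filter fun i => z i % 2 = 1).card

/-- A set of grid cells that contains all faces of its members. -/
def IsGridComplex {d : ℕ} (K : Finset (Fin d → ℤ)) : Prop := ∀ z ∈ K, ∀ z', GridFace z' z → z' ∈ K

theorem GridFace.refl {d : ℕ} (z : Fin d → ℤ) : GridFace z z := fun _ => ⟨le_rfl, le_rfl⟩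

theorem GridFace.trans {d : ℕ} {a b c : Fin d → ℤ} (h : GridFace a b) (h' : GridFace b c) :
    GridFace a c := fun i => ⟨(h' i).1.trans (h i).1, (h i).2.trans (h' i).2⟩

theorem GridFace.dim_lt {d : ℕ} {z' z : Fin d → ℤ} (h : GridFace z' z) (hne : z' ≠ z) :
    gridDim z' < gridDim z := by
  refine Finset.card_lt_card (Finset.ssubset_iff_subset_ne.2 ⟨fun i hi => ?_, fun heq => hne ?_⟩)
  · have h1 := h i
    simp only [Finset.mem_filter, Finset.mem_univ, true_and] at hi ⊢
    omega
  · ext i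
    have h1 := h i
    have h2 : (z' i % 2 = 1) ↔ (z i % 2 = 1) := by
      simpa using Finset.ext_iff.1 heq i
    omega

theorem ceil_sub_floor_cases (x : ℝ) : ⌈x⌉ = ⌊x⌋ ∨ ⌈x⌉ = ⌊x⌋ + 1 := by
  have h1 := Int.floor_le_ceil x
  have h2 := Int.ceil_le_floor_add_one x
  omega

theorem floor_add_ceil_div (x : ℝ) :
    (⌊x⌋ + ⌈x⌉) / 2 = ⌊x⌋ ∧ (⌊x⌋ + ⌈x⌉ + 1) / 2 = ⌈x⌉ := by
  rcases ceil_sub_floor_cases x with h | h <;> omega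

theorem mem_gridCell {d : ℕ} {x : Fin d → ℝ} {z : Fin d → ℤ} :
    x ∈ gridCell z ↔ ∀ i, ((z i / 2 : ℤ) : ℝ) ≤ x i ∧ x i ≤ (((z i + 1) / 2 : ℤ) : ℝ) := by
  refine forall_congr' fun i => ?_
  rw [gridCode, (floor_add_ceil_div _).1, (floor_add_ceil_div _).2, Int.le_floor, Int.ceil_le]

theorem isClosed_gridCell {d : ℕ} (z : Fin d → ℤ) : IsClosed (gridCell z) := by
  have : gridCell z = ⋂ i, {x | ((z i / 2 : ℤ) : ℝ) ≤ x i ∧ x i ≤ (((z i + 1) / 2 : ℤ) : ℝ)} := by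
    ext x; simp [mem_gridCell]
  rw [this]
  exact isClosed_iInter fun i => (isClosed_le continuous_const (continuous_apply i)).inter
    (isClosed_le (continuous_apply i) continuous_const)

theorem IsGridComplex.polyhedron_eq {d : ℕ} {K : Finset (Fin d → ℤ)} (hK : IsGridComplex K) :
    gridPolyhedron K = ⋃ z ∈ K, gridCell z := by
  ext x
  simp only [gridPolyhedron, gridCell, mem_ofPred_eq, mem_iUnion, exists_prop]
  exact ⟨fun h => ⟨_, h, GridFace.refl _⟩, fun ⟨z, hz, h⟩ => hK z hz _ h⟩

theorem IsGridComplex.isClosed {d : ℕ} {K : Finset (Fin d → ℤ)} (hK : IsGridComplex K) :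
    IsClosed (gridPolyhedron K) := by
  rw [hK.polyhedron_eq]
  exact K.finite_toSet.isClosed_biUnion fun z _ => isClosed_gridCell z

theorem dist_le_one_of_mem_gridCell {d : ℕ} {x y : Fin d → ℝ} {z : Fin d → ℤ}
    (hx : x ∈ gridCell z) (hy : y ∈ gridCell z) : dist x y ≤ 1 := by
  rw [dist_pi_le_iff zero_le_one]
  intro i
  have h1 := mem_gridCell.1 hx i
  have h2 := mem_gridCell.1 hy i
  have h3 : (((z i + 1) / 2 : ℤ) : ℝ) ≤ ((z i / 2 : ℤ) : ℝ) + 1 := by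
    exact_mod_cast (by omega : (z i + 1) / 2 ≤ z i / 2 + 1)
  rw [Real.dist_eq, abs_le]
  constructor <;> linarith

theorem gridCell_nonempty {d : ℕ} (z : Fin d → ℤ) : (gridCell z).Nonempty :=
  ⟨fun i => ((z i / 2 : ℤ) : ℝ), mem_gridCell.2 fun i =>
    ⟨le_rfl, by exact_mod_cast (by omega : z i / 2 ≤ (z i + 1) / 2)⟩⟩

theorem coe_of_odd {a : ℤ} (h : a % 2 = 1) :
    ((a / 2 : ℤ) : ℝ) = (a - 1) / 2 ∧ (((a + 1) / 2 : ℤ) : ℝ) = (a + 1) / 2 := by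
  have h1 : 2 * (a / 2) = a - 1 := by omega
  have h2 : 2 * ((a + 1) / 2) = a + 1 := by omega
  have h1' : (2 : ℝ) * ((a / 2 : ℤ) : ℝ) = a - 1 := by exact_mod_cast h1
  have h2' : (2 : ℝ) * (((a + 1) / 2 : ℤ) : ℝ) = a + 1 := by exact_mod_cast h2
  constructor <;> linarith

theorem coe_of_even {a : ℤ} (h : ¬ a % 2 = 1) :
    ((a / 2 : ℤ) : ℝ) = a / 2 ∧ (((a + 1) / 2 : ℤ) : ℝ) = a / 2 := by
  have h1 : 2 * (a / 2) = a := by omega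
  have h2 : 2 * ((a + 1) / 2) = a := by omega
  have h1' : (2 : ℝ) * ((a / 2 : ℤ) : ℝ) = a := by exact_mod_cast h1
  have h2' : (2 : ℝ) * (((a + 1) / 2 : ℤ) : ℝ) = a := by exact_mod_cast h2
  constructor <;> linarith

theorem mem_gridCell_iff_abs {d : ℕ} {x : Fin d → ℝ} {z : Fin d → ℤ} :
    x ∈ gridCell z ↔ (∀ i, z i % 2 = 1 → |2 * x i - z i| ≤ 1) ∧
      ∀ i, ¬ z i % 2 = 1 → x i = z i / 2 := by
  rw [mem_gridCell, ← forall_and]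
  refine forall_congr' fun i => ?_
  by_cases h : z i % 2 = 1
  · simp only [h, coe_of_odd h, abs_le]
    constructor
    · rintro ⟨h1, h2⟩; exact ⟨fun _ => ⟨by linarith, by linarith⟩, fun h => absurd trivial h⟩
    · rintro ⟨h1, -⟩; obtain ⟨h2, h3⟩ := h1 trivial; constructor <;> linarith
  · simp only [h, coe_of_even h]
    constructor
    · rintro ⟨h1, h2⟩; exact ⟨fun h => h.elim, fun _ => le_antisymm h2 h1⟩
    · rintro ⟨-, h1⟩; rw [h1 not_false]; exact ⟨le_rfl, le_rfl⟩

theorem gridCode_ne_iff {d : ℕ} {x : Fin d → ℝ} {z : Fin d → ℤ} (hx : x ∈ gridCell z) :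
    gridCode x ≠ z ↔ ∃ i, z i % 2 = 1 ∧ |2 * x i - z i| = 1 := by
  rw [Function.ne_iff]
  refine exists_congr fun i => ?_
  have hf : gridCode x i = ⌊x i⌋ + ⌈x i⌉ := rfl
  have h1 := Int.floor_le (x i)
  have h2 := Int.lt_floor_add_one (x i)
  have h3 := Int.le_ceil (x i)
  have h4 := hx i
  constructor
  · intro hne
    have hodd : z i % 2 = 1 := by omega
    refine ⟨hodd, ?_⟩
    have hceil : ⌈x i⌉ = ⌊x i⌋ := by
      rcases ceil_sub_floor_cases (x i) with h | h <;> omega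
    have hxi : x i = ⌊x i⌋ := le_antisymm (hceil ▸ h3) h1
    have hcase : 2 * ⌊x i⌋ - z i = 1 ∨ 2 * ⌊x i⌋ - z i = -1 := by omega
    rw [hxi, abs_eq zero_le_one]
    exact_mod_cast hcase
  · rintro ⟨hodd, habs⟩ heq
    have hne : ⌈x i⌉ = ⌊x i⌋ + 1 := by
      rcases ceil_sub_floor_cases (x i) with h | h <;> omega
    have hzi : z i = 2 * ⌊x i⌋ + 1 := by omega
    have hlt : (⌊x i⌋ : ℝ) < x i := by
      refine lt_of_le_of_ne h1 fun h => ?_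
      have : ⌈x i⌉ = ⌊x i⌋ := by conv_lhs => rw [← h, Int.ceil_intCast]
      omega
    have hzr : (z i : ℝ) = 2 * ⌊x i⌋ + 1 := by exact_mod_cast hzi
    rw [hzr, abs_eq zero_le_one] at habs
    rcases habs with h | h <;> linarith

theorem isCell_gridCell {d : ℕ} (z : Fin d → ℤ) :
    IsCell (gridDim z) (gridCell z) {x | x ∈ gridCell z ∧ gridCode x ≠ z} := by
  classical
  have e : {i // z i % 2 = 1} ≃ Fin (gridDim z) :=
    Fintype.equivFinOfCardEq (by rw [Fintype.card_subtype, gridDim])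
  set φ : (Fin (gridDim z) → ℝ) → Fin d → ℝ :=
    fun u i => if h : z i % 2 = 1 then z i / 2 + u (e ⟨i, h⟩) / 2 else z i / 2 with hφ
  have h1 : ∀ u i (h : z i % 2 = 1), 2 * φ u i - z i = u (e ⟨i, h⟩) := fun u i h => by
    simp only [hφ, h, dif_pos]; ring
  have h2 : ∀ u, u ∈ closedBall 0 1 → φ u ∈ gridCell z := fun u hu => by
    have hu' := mem_closedBall_pi.1 hu
    refine mem_gridCell_iff_abs.2 ⟨fun i h => ?_, fun i h => ?_⟩
    · rw [h1 u i h]; exact hu' _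
    · simp [hφ, h]
  have h3 : ∀ x ∈ gridCell z, (fun j => 2 * x (e.symm j) - z (e.symm j)) ∈
      closedBall (0 : Fin (gridDim z) → ℝ) 1 := fun x hx =>
    mem_closedBall_pi.2 fun j => (mem_gridCell_iff_abs.1 hx).1 _ (e.symm j).2
  refine ⟨fun x hx => hx.1, φ, fun x j => 2 * x (e.symm j) - z (e.symm j), ?_, ?_, ?_, ?_, ?_,
    ?_, ?_⟩
  · refine continuous_pi fun i => ?_
    by_cases h : z i % 2 = 1
    · simp only [hφ, h, dif_pos]; fun_prop
    · simp only [hφ, h, dif_neg, not_false_eq_true]; fun_prop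
  · fun_prop
  · intro u hu
    refine ⟨h2 u (sphere_subset_closedBall hu), ?_⟩
    rw [gridCode_ne_iff (h2 u (sphere_subset_closedBall hu))]
    obtain ⟨-, j, hj⟩ := mem_sphere_pi.1 hu
    refine ⟨e.symm j, (e.symm j).2, ?_⟩
    rw [h1 u _ (e.symm j).2]
    simpa using hj
  · exact h2
  · rintro x ⟨hx, hne⟩
    obtain ⟨i, hi, habs⟩ := (gridCode_ne_iff hx).1 hne
    exact mem_sphere_pi.2 ⟨mem_closedBall_pi.1 (h3 x hx), e ⟨i, hi⟩, by simpa using habs⟩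
  · exact h3
  · intro x hx
    ext i
    by_cases h : z i % 2 = 1
    · simp only [hφ, h, dif_pos, Equiv.symm_apply_apply]; ring
    · simp only [hφ, h]; exact ((mem_gridCell_iff_abs.1 hx).2 i h).symm

open Classical in
/-- Extension of homotopies to a constant map from one grid complex to a larger one. -/
theorem IsNullhomotopyOn.extend_grid {d N : ℕ} {W : Type*} [TopologicalSpace W]
    {f : (Fin d → ℝ) → W} {y : W} {Y : Set W} (hY : SphereExt N Y) (hy : y ∈ Y)
    {L K : Finset (Fin d → ℤ)} (hL : IsGridComplex L) (hK : IsGridComplex K) (hLK : L ⊆ K)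
    (hdim : ∀ z ∈ K, z ∉ L → gridDim z + 1 ≤ N) (hf : ContinuousOn f (gridPolyhedron K))
    (hfY : MapsTo f (gridPolyhedron K) Y) {H : (Fin d → ℝ) × ℝ → W}
    (h : IsNullhomotopyOn f y Y (gridPolyhedron L) H) :
    ∃ G, IsNullhomotopyOn f y Y (gridPolyhedron K) G ∧
      EqOn G H (gridPolyhedron L ×ˢ Icc 0 1) := by
  induction hn : (K \ L).card generalizing K with
  | zero =>
    have : K = L := subset_antisymm (Finset.sdiff_eq_empty_iff_subset.1 (Finset.card_eq_zero.1 hn))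
      hLK
    subst this
    exact ⟨H, h, fun _ _ => rfl⟩
  | succ m ih =>
    obtain ⟨z, hz, hmax⟩ := Finset.exists_max_image (K \ L) gridDim
      (Finset.card_pos.1 (by omega))
    obtain ⟨hzK, hzL⟩ := Finset.mem_sdiff.1 hz
    have hK' : IsGridComplex (K.erase z) := by
      intro w hw w' hw'
      obtain ⟨hwz, hwK⟩ := Finset.mem_erase.1 hw
      refine Finset.mem_erase.2 ⟨?_, hK w hwK w' hw'⟩
      rintro rfl
      by_cases hwL : w ∈ L
      · exact hzL (hL w hwL _ hw')
      · exact absurd (hmax w (Finset.mem_sdiff.2 ⟨hwK, hwL⟩))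
          (not_le.2 (hw'.dim_lt (Ne.symm hwz)))
    have hsub : gridPolyhedron (K.erase z) ⊆ gridPolyhedron K := fun x hx =>
      Finset.mem_of_mem_erase hx
    have hcsub : gridCell z ⊆ gridPolyhedron K := fun x hx => hK z hzK _ hx
    obtain ⟨G, hG, hGH⟩ := ih hK' (fun w hw => Finset.mem_erase.2 ⟨fun e => hzL (e ▸ hw), hLK hw⟩)
      (fun w hw => hdim w (Finset.mem_of_mem_erase hw)) (hf.mono hsub) (hfY.mono_left hsub) (by
        rw [Finset.erase_sdiff_comm, Finset.card_erase_of_mem hz, hn]; rfl)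
    have hinter : gridPolyhedron (K.erase z) ∩ gridCell z =
        {x | x ∈ gridCell z ∧ gridCode x ≠ z} := by
      ext x
      simp only [gridPolyhedron, mem_inter_iff, mem_ofPred_eq, Finset.mem_erase]
      exact ⟨fun hx => ⟨hx.2, hx.1.1⟩, fun hx => ⟨⟨hx.2, hcsub hx.1⟩, hx.1⟩⟩
    have hunion : gridPolyhedron (K.erase z) ∪ gridCell z = gridPolyhedron K := by
      refine subset_antisymm (union_subset hsub hcsub) fun x hx => ?_
      by_cases hxz : gridCode x = z
      · exact Or.inr (show GridFace _ _ from hxz ▸ GridFace.refl _)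
      · exact Or.inl (Finset.mem_erase.2 ⟨hxz, hx⟩)
    obtain ⟨G', hG', hGG'⟩ := IsNullhomotopyOn.extend_cell hK'.isClosed (isClosed_gridCell z)
      (hinter ▸ isCell_gridCell z) (hdim z hzK hzL) hY hy (hf.mono hcsub) (hfY.mono_left hcsub) hG
    refine ⟨G', hunion ▸ hG', fun x hx => (hGG' ⟨?_, hx.2⟩).trans (hGH hx)⟩
    exact Finset.mem_erase.2 ⟨fun e => hzL (e ▸ hx.1), hLK hx.1⟩

/-- A map on the unit sphere which is homotopic to the restriction of a map on the ball extends to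
the ball. -/
theorem exists_extension_of_homotopy {d : ℕ} {W : Type*} [TopologicalSpace W] {Y : Set W}
    {f g₁ : (Fin d → ℝ) → W} {H : (Fin d → ℝ) × ℝ → W}
    (hH : ContinuousOn H (sphere 0 1 ×ˢ Icc 0 1)) (hHY : MapsTo H (sphere 0 1 ×ˢ Icc 0 1) Y)
    (hH0 : ∀ x ∈ sphere (0 : Fin d → ℝ) 1, H (x, 0) = f x)
    (hH1 : ∀ x ∈ sphere (0 : Fin d → ℝ) 1, H (x, 1) = g₁ x)
    (hg : ContinuousOn g₁ (closedBall 0 1)) (hgY : MapsTo g₁ (closedBall 0 1) Y) :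
    ∃ g : (Fin d → ℝ) → W, ContinuousOn g (closedBall 0 1) ∧
      MapsTo g (closedBall 0 1) Y ∧ EqOn g f (sphere 0 1) := by
  set A : Set (Fin d → ℝ) := {x | ‖x‖ ≤ 1 / 2} with hA
  set B : Set (Fin d → ℝ) := {x | 1 / 2 ≤ ‖x‖ ∧ ‖x‖ ≤ 1} with hB
  have hAB : closedBall (0 : Fin d → ℝ) 1 = A ∪ B := by
    ext x
    simp only [mem_closedBall_zero_iff, hA, hB, mem_union, mem_ofPred_eq]
    constructor
    · intro h
      rcases le_total ‖x‖ (1 / 2) with h' | h'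
      exacts [Or.inl h', Or.inr ⟨h', h⟩]
    · rintro (h | h) <;> linarith
  set g : (Fin d → ℝ) → W := fun x =>
    if ‖x‖ ≤ 1 / 2 then g₁ ((2 : ℝ) • x) else H (‖x‖⁻¹ • x, 2 * (1 - ‖x‖)) with hgdef
  have e1 : EqOn g (fun x => g₁ ((2 : ℝ) • x)) A := fun x hx => if_pos hx
  have mapB : MapsTo (fun x : Fin d → ℝ => (‖x‖⁻¹ • x, 2 * (1 - ‖x‖))) B
      (sphere 0 1 ×ˢ Icc 0 1) := by
    rintro x ⟨h1, h2⟩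
    refine ⟨?_, ?_, ?_⟩
    · rw [mem_sphere_zero_iff_norm, norm_smul, norm_inv, norm_norm, inv_mul_cancel₀]
      intro h; linarith
    · dsimp only; linarith
    · dsimp only; linarith
  have e2 : EqOn g (fun x => H (‖x‖⁻¹ • x, 2 * (1 - ‖x‖))) B := by
    rintro x ⟨h1, h2⟩
    by_cases hx : ‖x‖ ≤ 1 / 2
    · have hx' : ‖x‖ = 1 / 2 := le_antisymm hx h1
      have h3 : ‖(2 : ℝ) • x‖ = 1 := by rw [norm_smul, hx']; norm_num
      simp only [hgdef, hx']
      norm_num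
      exact (hH1 _ (mem_sphere_zero_iff_norm.2 h3)).symm
    · exact if_neg hx
  have contB : ContinuousOn (fun x : Fin d → ℝ => (‖x‖⁻¹ • x, 2 * (1 - ‖x‖))) B := by
    have hinv : ContinuousOn (fun x : Fin d → ℝ => ‖x‖⁻¹) B :=
      ContinuousOn.inv₀ continuous_norm.continuousOn fun x hx h => by linarith [hx.1]
    exact (hinv.smul continuousOn_id).prodMk (by fun_prop)
  have mapA : MapsTo (fun x : Fin d → ℝ => (2 : ℝ) • x) A (closedBall 0 1) := fun x hx => by
    rw [mem_closedBall_zero_iff, norm_smul, Real.norm_ofNat]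
    have : ‖x‖ ≤ 1 / 2 := hx
    linarith
  refine ⟨g, ?_, ?_, fun x hx => ?_⟩
  · rw [hAB]
    refine ContinuousOn.union_of_isClosed ?_ ?_ ?_ ?_
    · exact (hg.comp (by fun_prop) mapA).congr e1
    · exact (hH.comp contB mapB).congr e2
    · exact isClosed_le continuous_norm continuous_const
    · exact (isClosed_le continuous_const continuous_norm).inter
        (isClosed_le continuous_norm continuous_const)
  · rw [hAB]
    exact ((hgY.comp mapA).congr e1.symm).union ((hHY.comp mapB).congr e2.symm)
  · have hx1 : ‖x‖ = 1 := mem_sphere_zero_iff_norm.1 hx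
    rw [e2 ⟨by rw [hx1]; norm_num, hx1.le⟩]
    simp [hx1, hH0 x hx]

/-- If `Y'` dominates `Y` up to straight-line homotopies, then `Y` is as connected as `Y'`. -/
theorem SphereExt.of_segment {N : ℕ} {W W' : Type*} [AddCommGroup W] [Module ℝ W]
    [TopologicalSpace W] [IsTopologicalAddGroup W] [ContinuousSMul ℝ W] [TopologicalSpace W']
    {Y : Set W} {Y' : Set W'} (h : SphereExt N Y') {r : W → W'} {i : W' → W}
    (hr : ContinuousOn r Y) (hrY : MapsTo r Y Y') (hi : ContinuousOn i Y') (hiY : MapsTo i Y' Y)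
    (hseg : ∀ w ∈ Y, segment ℝ w (i (r w)) ⊆ Y) : SphereExt N Y := by
  refine ⟨h.1.image i |>.mono (image_subset_iff.2 hiY), fun d hd f hf hfY => ?_⟩
  obtain ⟨g, hg, hgY, hgf⟩ := h.2 d hd (r ∘ f) (hr.comp hf hfY) (hrY.comp hfY)
  have c1 : ContinuousOn (fun x : (Fin d → ℝ) × ℝ => f x.1) (sphere 0 1 ×ˢ Icc 0 1) :=
    hf.comp continuousOn_fst fun x hx => hx.1
  have c2 : ContinuousOn (fun x : (Fin d → ℝ) × ℝ => i (r (f x.1))) (sphere 0 1 ×ˢ Icc 0 1) :=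
    hi.comp (hr.comp c1 fun x hx => hfY hx.1) fun x hx => hrY (hfY hx.1)
  refine exists_extension_of_homotopy (f := f) (g₁ := i ∘ g)
    (H := fun x => (1 - x.2) • f x.1 + x.2 • i (r (f x.1))) ?_ ?_ ?_ ?_
    (hi.comp hg hgY) (hiY.comp hgY)
  · exact ContinuousOn.add (ContinuousOn.smul (by fun_prop) c1) (ContinuousOn.smul (by fun_prop) c2)
  · rintro ⟨x, t⟩ ⟨hx, ht0, ht1⟩
    exact hseg _ (hfY hx) ⟨1 - t, t, sub_nonneg.2 ht1, ht0, by ring, rfl⟩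
  · intro x hx; simp
  · intro x hx; simp [hgf hx]

theorem sphereExt_singleton {W : Type*} [TopologicalSpace W] (N : ℕ) (y : W) :
    SphereExt N ({y} : Set W) :=
  ⟨singleton_nonempty y, fun _ _ _ _ hfY => ⟨fun _ => y, continuousOn_const, fun _ _ => rfl,
    fun _ hx => (hfY hx).symm⟩⟩

theorem SphereExt.of_starConvex {N : ℕ} {W : Type*} [AddCommGroup W] [Module ℝ W]
    [TopologicalSpace W] [IsTopologicalAddGroup W] [ContinuousSMul ℝ W] {Y : Set W} {y : W}
    (hy : y ∈ Y) (h : ∀ w ∈ Y, segment ℝ w y ⊆ Y) : SphereExt N Y :=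
  (sphereExt_singleton N y).of_segment (r := fun _ => y) (i := id) continuousOn_const
    (fun _ _ => rfl) continuousOn_id (by rintro _ rfl; exact hy) h

/-- The codes of the grid cells that make up the boundary of the cube `[-M, M]^d`. -/
noncomputable def sphereGrid (d M : ℕ) : Finset (Fin d → ℤ) :=
  (Fintype.piFinset fun _ => Finset.Icc (-(2 * M : ℤ)) (2 * M)).filter
    fun z => ∃ i, z i = 2 * M ∨ z i = -(2 * M)

theorem mem_sphereGrid {d M : ℕ} {z : Fin d → ℤ} : z ∈ sphereGrid d M ↔
    (∀ i, -(2 * M : ℤ) ≤ z i ∧ z i ≤ 2 * M) ∧ ∃ i, z i = 2 * M ∨ z i = -(2 * M) := by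
  simp [sphereGrid]

theorem isGridComplex_sphereGrid (d M : ℕ) : IsGridComplex (sphereGrid d M) := by
  intro z hz z' h
  rw [mem_sphereGrid] at hz ⊢
  obtain ⟨h1, i, hi⟩ := hz
  refine ⟨fun j => ?_, i, ?_⟩
  · have := h1 j; have := h j; omega
  · have := h1 i; have := h i; omega

theorem gridDim_lt_of_mem_sphereGrid {d M : ℕ} {z : Fin d → ℤ} (hz : z ∈ sphereGrid d M) :
    gridDim z < d := by
  obtain ⟨-, i, hi⟩ := mem_sphereGrid.1 hz
  have : gridDim z < Fintype.card (Fin d) := Finset.card_lt_univ_of_notMem (x := i) (by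
    simp only [Finset.mem_filter, Finset.mem_univ, true_and]; omega)
  simpa using this

theorem gridPolyhedron_sphereGrid {d M : ℕ} (hM : 0 < M) :
    gridPolyhedron (sphereGrid d M) = {x | (M : ℝ)⁻¹ • x ∈ sphere (0 : Fin d → ℝ) 1} := by
  have hM' : (0 : ℝ) < M := by exact_mod_cast hM
  ext x
  simp only [gridPolyhedron, mem_ofPred_eq, mem_sphereGrid, mem_sphere_pi, Pi.smul_apply,
    smul_eq_mul, abs_mul, abs_inv, Nat.abs_cast]
  refine and_congr (forall_congr' fun i => ?_) (exists_congr fun i => ?_)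
  · have h1 : (-(2 * M : ℤ) ≤ gridCode x i ∧ gridCode x i ≤ 2 * M) ↔
        (-(M : ℤ) ≤ ⌊x i⌋ ∧ ⌈x i⌉ ≤ (M : ℤ)) := by
      have hf : gridCode x i = ⌊x i⌋ + ⌈x i⌉ := rfl
      rcases ceil_sub_floor_cases (x i) with h | h <;> omega
    rw [h1, Int.le_floor, Int.ceil_le, inv_mul_le_iff₀ hM', mul_one, abs_le]
    push_cast; rfl
  · have h1 : ∀ a : ℤ, gridCode x i = 2 * a ↔ x i = a := by
      intro a
      have hf : gridCode x i = ⌊x i⌋ + ⌈x i⌉ := rfl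
      constructor
      · intro h
        have h2 : ⌊x i⌋ = a ∧ ⌈x i⌉ = a := by
          rcases ceil_sub_floor_cases (x i) with h | h <;> omega
        have h3 := Int.floor_le (x i)
        have h4 := Int.le_ceil (x i)
        rw [h2.1] at h3; rw [h2.2] at h4
        exact le_antisymm h4 h3
      · intro h
        rw [hf, h, Int.floor_intCast, Int.ceil_intCast]; ring
    rw [inv_mul_eq_one₀ hM'.ne', eq_comm (a := (M : ℝ)), abs_eq hM'.le, h1 M,
      show -(2 * (M : ℤ)) = 2 * (-(M : ℤ)) by ring, h1 (-M)]
    push_cast; rfl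

/-- Every cell of a sufficiently fine grid on the sphere lies in one of two open sets. -/
theorem exists_fine_sphereGrid {d : ℕ} {W : Type*} [TopologicalSpace W] {O₁ O₂ : Set W}
    (h₁ : IsOpen O₁) (h₂ : IsOpen O₂) {f : (Fin d → ℝ) → W} (hf : ContinuousOn f (sphere 0 1))
    (hfO : MapsTo f (sphere 0 1) (O₁ ∪ O₂)) :
    ∃ M : ℕ, 0 < M ∧ ∀ z ∈ sphereGrid d M,
      MapsTo (fun x => f ((M : ℝ)⁻¹ • x)) (gridCell z) O₁ ∨
      MapsTo (fun x => f ((M : ℝ)⁻¹ • x)) (gridCell z) O₂ := by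
  obtain ⟨u₁, hu₁, hfu₁⟩ := continuousOn_iff'.1 hf O₁ h₁
  obtain ⟨u₂, hu₂, hfu₂⟩ := continuousOn_iff'.1 hf O₂ h₂
  obtain ⟨δ, hδ, hball⟩ := lebesgue_number_lemma_of_metric (isCompact_sphere (0 : Fin d → ℝ) 1)
    (c := fun b : Bool => if b then u₁ else u₂) (by intro b; cases b <;> simpa) (by
      intro x hx
      rcases hfO hx with h | h
      · exact mem_iUnion.2 ⟨true, by
          have : x ∈ u₁ ∩ sphere 0 1 := hfu₁ ▸ ⟨h, hx⟩
          simpa using this.1⟩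
      · exact mem_iUnion.2 ⟨false, by
          have : x ∈ u₂ ∩ sphere 0 1 := hfu₂ ▸ ⟨h, hx⟩
          simpa using this.1⟩)
  obtain ⟨n, hn⟩ := exists_nat_one_div_lt hδ
  have hM : 0 < n + 1 := n.succ_pos
  refine ⟨n + 1, hM, fun z hz => ?_⟩
  have hsub : ∀ x ∈ gridCell z, ((n + 1 : ℕ) : ℝ)⁻¹ • x ∈ sphere (0 : Fin d → ℝ) 1 := fun x hx => by
    have : x ∈ gridPolyhedron (sphereGrid d (n + 1)) := isGridComplex_sphereGrid d _ z hz _ hx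
    rwa [gridPolyhedron_sphereGrid hM] at this
  obtain ⟨x₀, hx₀⟩ := gridCell_nonempty z
  have hclose : ∀ x ∈ gridCell z, ((n + 1 : ℕ) : ℝ)⁻¹ • x ∈ ball (((n + 1 : ℕ) : ℝ)⁻¹ • x₀) δ := by
    intro x hx
    rw [mem_ball, dist_smul₀, norm_inv, Real.norm_natCast]
    refine lt_of_le_of_lt (mul_le_of_le_one_right (by positivity)
      (dist_le_one_of_mem_gridCell hx hx₀)) ?_
    rw [← one_div]; push_cast; exact hn
  obtain ⟨b, hb⟩ := hball _ (hsub x₀ hx₀)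
  cases b
  · refine Or.inr fun x hx => ?_
    have : ((n + 1 : ℕ) : ℝ)⁻¹ • x ∈ f ⁻¹' O₂ ∩ sphere 0 1 :=
      hfu₂ ▸ ⟨by simpa using hb (hclose x hx), hsub x hx⟩
    exact this.1
  · refine Or.inl fun x hx => ?_
    have : ((n + 1 : ℕ) : ℝ)⁻¹ • x ∈ f ⁻¹' O₁ ∩ sphere 0 1 :=
      hfu₁ ▸ ⟨by simpa using hb (hclose x hx), hsub x hx⟩
    exact this.1

open Classical in
/-- A space that is the union of two `N`-connected open subspaces with an `(N - 1)`-connected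
intersection is `N`-connected. -/
theorem SphereExt.union_isOpen {N : ℕ} {W : Type*} [TopologicalSpace W] {X O₁ O₂ : Set W}
    (hO₁ : IsOpen O₁) (hO₂ : IsOpen O₂) (hX : X ⊆ O₁ ∪ O₂) (h₁ : SphereExt (N + 1) (X ∩ O₁))
    (h₂ : SphereExt (N + 1) (X ∩ O₂)) (h₁₂ : SphereExt N (X ∩ (O₁ ∩ O₂))) :
    SphereExt (N + 1) X := by
  obtain ⟨y, hy⟩ := h₁₂.1
  refine ⟨⟨y, hy.1⟩, fun d hd f hf hfX => ?_⟩
  obtain ⟨M, hM, hcell⟩ := exists_fine_sphereGrid hO₁ hO₂ hf (hfX.mono_right hX)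
  have hM' : (0 : ℝ) < M := by exact_mod_cast hM
  set K := sphereGrid d M with hKdef
  set f' : (Fin d → ℝ) → W := fun x => f ((M : ℝ)⁻¹ • x) with hf'def
  have hK : IsGridComplex K := isGridComplex_sphereGrid d M
  have hKs := gridPolyhedron_sphereGrid (d := d) hM
  have hf' : ContinuousOn f' (gridPolyhedron K) := by
    refine hf.comp (by fun_prop) fun x hx => ?_
    rw [hKdef, hKs] at hx; exact hx
  have hf'X : MapsTo f' (gridPolyhedron K) X := fun x hx => by
    rw [hKdef, hKs] at hx; exact hfX hx
  set P := K.filter fun z => MapsTo f' (gridCell z) O₁ with hPdef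
  set Q := K.filter fun z => ∃ z' ∈ K, z' ∉ P ∧ GridFace z z' with hQdef
  have cell_mono : ∀ {z z' : Fin d → ℤ}, GridFace z' z → gridCell z' ⊆ gridCell z :=
    fun h x hx => GridFace.trans hx h
  have hP : IsGridComplex P := fun z hz z' h => by
    obtain ⟨h1, h2⟩ := Finset.mem_filter.1 hz
    exact Finset.mem_filter.2 ⟨hK z h1 z' h, h2.mono_left (cell_mono h)⟩
  have hQ : IsGridComplex Q := fun z hz z' h => by
    obtain ⟨h1, w, h2, h3, h4⟩ := Finset.mem_filter.1 hz
    exact Finset.mem_filter.2 ⟨hK z h1 z' h, w, h2, h3, h.trans h4⟩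
  have hPQ : IsGridComplex (P ∩ Q) := fun z hz z' h =>
    Finset.mem_inter.2 ⟨hP z (Finset.mem_inter.1 hz).1 z' h, hQ z (Finset.mem_inter.1 hz).2 z' h⟩
  have hPK : gridPolyhedron P ⊆ gridPolyhedron K := fun x hx => (Finset.mem_filter.1 hx).1
  have hQK : gridPolyhedron Q ⊆ gridPolyhedron K := fun x hx => (Finset.mem_filter.1 hx).1
  have hPQK : gridPolyhedron P ∪ gridPolyhedron Q = gridPolyhedron K := by
    refine subset_antisymm (union_subset hPK hQK) fun x hx => ?_
    by_cases hxP : gridCode x ∈ P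
    · exact Or.inl hxP
    · exact Or.inr (Finset.mem_filter.2 ⟨hx, _, hx, hxP, GridFace.refl _⟩)
  have hmem : ∀ {x : Fin d → ℝ}, x ∈ gridCell (gridCode x) := fun {x} => GridFace.refl _
  have hfP : MapsTo f' (gridPolyhedron P) (X ∩ O₁) := fun x hx =>
    ⟨hf'X (hPK hx), (Finset.mem_filter.1 hx).2 hmem⟩
  have hfQ : MapsTo f' (gridPolyhedron Q) (X ∩ O₂) := fun x hx => by
    obtain ⟨-, w, hw, hwP, hface⟩ := Finset.mem_filter.1 hx
    refine ⟨hf'X (hQK hx), ?_⟩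
    rcases hcell w hw with h | h
    · exact absurd (Finset.mem_filter.2 ⟨hw, h⟩) hwP
    · exact h (cell_mono hface hmem)
  have hdimK : ∀ z ∈ K, gridDim z + 1 ≤ N + 1 := fun z hz =>
    (gridDim_lt_of_mem_sphereGrid hz).trans_le hd
  have hinter : gridPolyhedron P ∩ gridPolyhedron Q = gridPolyhedron (P ∩ Q) := by
    ext x; simp [gridPolyhedron]
  have hPQP : gridPolyhedron (P ∩ Q) ⊆ gridPolyhedron P := hinter ▸ inter_subset_left
  have hPQQ : gridPolyhedron (P ∩ Q) ⊆ gridPolyhedron Q := hinter ▸ inter_subset_right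
  obtain ⟨H₀, hH₀, -⟩ := IsNullhomotopyOn.extend_grid (L := ∅) (K := P ∩ Q) (f := f')
    (H := fun _ => y) h₁₂ hy (fun z hz => absurd hz (Finset.notMem_empty z)) hPQ
    (Finset.empty_subset _) (fun z hz _ => by
      obtain ⟨hzP, hzQ⟩ := Finset.mem_inter.1 hz
      obtain ⟨-, w, hw, hwP, hface⟩ := Finset.mem_filter.1 hzQ
      have h1 := hdimK w hw
      have h2 := hface.dim_lt (by rintro rfl; exact hwP hzP)
      omega)
    (hf'.mono (hPQP.trans hPK)) (fun x hx => ⟨hf'X (hPK (hPQP hx)), (hfP (hPQP hx)).2,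
      (hfQ (hPQQ hx)).2⟩)
    ⟨continuousOn_const, fun _ _ => hy, fun x hx => absurd hx (Finset.notMem_empty _)⟩
  obtain ⟨H₁, hH₁, hH₁₀⟩ := IsNullhomotopyOn.extend_grid h₁ ⟨hy.1, hy.2.1⟩ hPQ hP
    Finset.inter_subset_left (fun z hz _ => hdimK z (Finset.mem_filter.1 hz).1) (hf'.mono hPK) hfP
    (hH₀.mono fun x hx => ⟨hx.1, hx.2.1⟩)
  obtain ⟨H₂, hH₂, hH₂₀⟩ := IsNullhomotopyOn.extend_grid h₂ ⟨hy.1, hy.2.2⟩ hPQ hQ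
    Finset.inter_subset_right (fun z hz _ => hdimK z (Finset.mem_filter.1 hz).1) (hf'.mono hQK) hfQ
    (hH₀.mono fun x hx => ⟨hx.1, hx.2.2⟩)
  obtain ⟨H, ⟨hHc, hHX, hHe⟩, -⟩ := IsNullhomotopyOn.union hP.isClosed hQ.isClosed
    (hH₁.mono inter_subset_left) (hH₂.mono inter_subset_left)
    (by rw [hinter]; exact hH₁₀.trans hH₂₀.symm)
  rw [hPQK, hKdef, hKs] at hHc hHX hHe
  have hscale : ∀ x : Fin d → ℝ, (M : ℝ)⁻¹ • (M : ℝ) • x = x := fun x =>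
    inv_smul_smul₀ hM'.ne' x
  have hmaps : MapsTo (fun x : (Fin d → ℝ) × ℝ => ((M : ℝ) • x.1, x.2)) (sphere 0 1 ×ˢ Icc 0 1)
      ({x | (M : ℝ)⁻¹ • x ∈ sphere (0 : Fin d → ℝ) 1} ×ˢ Icc 0 1) := fun x hx =>
    ⟨by simpa only [mem_ofPred_eq, hscale] using hx.1, hx.2⟩
  refine exists_extension_of_homotopy (g₁ := fun _ => y) (hHc.comp (by fun_prop) hmaps)
    (hHX.comp hmaps) (fun x hx => ?_) (fun x hx => ?_) continuousOn_const fun _ _ => hy.1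
  · have := (hHe ((M : ℝ) • x) (by simpa only [mem_ofPred_eq, hscale] using hx)).1
    simpa only [hf'def, hscale, Function.comp_apply] using this
  · exact (hHe ((M : ℝ) • x) (by simpa only [mem_ofPred_eq, hscale] using hx)).2

open unitInterval in
theorem SphereExt.isNConnected {W : Type*} [TopologicalSpace W] {n : ℕ} {X : Set W}
    (h : SphereExt (n + 1) X) : IsNConnected n X := by
  refine ⟨h.1.to_subtype, fun i hi x => ⟨fun a b => Quotient.inductionOn₂ a b fun p q => ?_⟩⟩
  refine Quotient.sound (?_ : p.1.HomotopicRel q.1 (Cube.boundary (Fin i)))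
  set c : (Fin (i + 1) → ℝ) → Fin i → I :=
    fun u j => projIcc 0 1 zero_le_one ((u j.succ + 1) / 2) with hc
  have hcc : Continuous c := continuous_pi fun j => continuous_projIcc.comp (by fun_prop)
  set F : (Fin (i + 1) → ℝ) → W :=
    fun u => if u 0 ≤ -1 then (p (c u) : W) else if 1 ≤ u 0 then (q (c u) : W) else x with hF
  set A : Set (Fin (i + 1) → ℝ) := {u | u 0 ≤ -1} with hA
  set B : Set (Fin (i + 1) → ℝ) := {u | 1 ≤ u 0} with hB
  set C : Set (Fin (i + 1) → ℝ) := ⋃ j : Fin i, {u | |u j.succ| = 1} with hC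
  have hAc : IsClosed A := isClosed_le (continuous_apply 0) continuous_const
  have hBc : IsClosed B := isClosed_le continuous_const (continuous_apply 0)
  have hCc : IsClosed C := isClosed_iUnion_of_finite fun j =>
    isClosed_eq (continuous_apply j.succ).abs continuous_const
  have eA : EqOn F (fun u => (p (c u) : W)) A := fun u hu => if_pos hu
  have eB : EqOn F (fun u => (q (c u) : W)) B := fun u hu => by
    have h1 : (1 : ℝ) ≤ u 0 := hu
    have h2 : ¬ u 0 ≤ -1 := by linarith
    simp only [hF, h1, h2, if_true, if_false]
  have eC : EqOn F (fun _ => (x : W)) C := fun u hu => by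
    obtain ⟨j, hj⟩ := mem_iUnion.1 hu
    have hb : c u ∈ Cube.boundary (Fin i) := by
      refine ⟨j, ?_⟩
      rcases (abs_eq zero_le_one).1 hj with h1 | h1
      · right; simp only [hc, h1]; norm_num
      · left; simp only [hc, h1]; norm_num
    have h1 : p (c u) = x := p.2 _ hb
    have h2 : q (c u) = x := q.2 _ hb
    simp only [hF, h1, h2, ite_self]
  have hsph : sphere (0 : Fin (i + 1) → ℝ) 1 ⊆ A ∪ (B ∪ C) := fun u hu => by
    obtain ⟨-, j, hj⟩ := mem_sphere_pi.1 hu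
    induction j using Fin.cases with
    | zero =>
      rcases (abs_eq zero_le_one).1 hj with h1 | h1
      · exact Or.inr (Or.inl h1.ge)
      · exact Or.inl h1.le
    | succ j => exact Or.inr (Or.inr (mem_iUnion.2 ⟨j, hj⟩))
  have hp : Continuous fun u => (p (c u) : W) :=
    continuous_subtype_val.comp (p.1.continuous.comp hcc)
  have hq : Continuous fun u => (q (c u) : W) :=
    continuous_subtype_val.comp (q.1.continuous.comp hcc)
  have hFc : ContinuousOn F (sphere 0 1) := by
    refine ContinuousOn.mono ?_ hsph
    exact (hp.continuousOn.congr eA).union_of_isClosed ((hq.continuousOn.congr eB).union_of_isClosed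
      (continuousOn_const.congr eC) hBc hCc) hAc (hBc.union hCc)
  have hFX : MapsTo F (sphere 0 1) X := fun u _ => by
    simp only [hF]
    split_ifs
    exacts [(p (c u)).2, (q (c u)).2, x.2]
  obtain ⟨G, hG, hGX, hGF⟩ := h.2 (i + 1) (by omega) F hFc hFX
  set e : I × (Fin i → I) → Fin (i + 1) → ℝ :=
    fun y => Fin.cons (2 * (y.1 : ℝ) - 1) fun j => 2 * (y.2 j : ℝ) - 1 with he
  have hec : Continuous e := continuous_pi fun j => by
    refine Fin.cases ?_ (fun j => ?_) j
    · simp only [he, Fin.cons_zero]; fun_prop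
    · simp only [he, Fin.cons_succ]; fun_prop
  have hle : ∀ t : I, |2 * (t : ℝ) - 1| ≤ 1 := fun t => by
    have h1 := t.2.1; have h2 := t.2.2
    rw [abs_le]; constructor <;> linarith
  have heb : ∀ y, e y ∈ closedBall (0 : Fin (i + 1) → ℝ) 1 := fun y => mem_closedBall_pi.2 fun j => by
    refine Fin.cases ?_ (fun j => ?_) j
    · simpa only [he, Fin.cons_zero] using hle y.1
    · simpa only [he, Fin.cons_succ] using hle (y.2 j)
  have hce : ∀ y, c (e y) = y.2 := fun y => by
    ext j
    simp only [hc, he, Fin.cons_succ]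
    rw [show (2 * (y.2 j : ℝ) - 1 + 1) / 2 = y.2 j by ring, projIcc_val]
  have hes : ∀ y, |e y 0| = 1 → e y ∈ sphere (0 : Fin (i + 1) → ℝ) 1 := fun y hy =>
    mem_sphere_pi.2 ⟨mem_closedBall_pi.1 (heb y), 0, hy⟩
  have hG0 : ∀ y, G (e (0, y)) = p y := fun y => by
    have h0 : e (0, y) 0 = -1 := by simp [he]
    rw [hGF (hes _ (by rw [h0]; norm_num)), eA h0.le]
    simp only [hce]
  have hG1 : ∀ y, G (e (1, y)) = q y := fun y => by
    have h0 : e (1, y) 0 = 1 := by simp [he]; norm_num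
    rw [hGF (hes _ (by rw [h0]; norm_num)), eB h0.ge]
    simp only [hce]
  have hGb : ∀ t, ∀ y ∈ Cube.boundary (Fin i), G (e (t, y)) = x := by
    rintro t y ⟨j, hj⟩
    have h1 : |e (t, y) j.succ| = 1 := by
      simp only [he, Fin.cons_succ]
      rcases hj with h | h <;> rw [h] <;> norm_num
    rw [hGF (mem_sphere_pi.2 ⟨mem_closedBall_pi.1 (heb _), j.succ, h1⟩),
      eC (mem_iUnion.2 ⟨j, h1⟩)]
  exact ⟨{ toFun := fun y => ⟨G (e y), hGX (heb y)⟩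
           continuous_toFun := (hG.comp_continuous hec heb).subtype_mk _
           map_zero_left := fun y => Subtype.ext (hG0 y)
           map_one_left := fun y => Subtype.ext (hG1 y)
           prop' := fun t y hy => Subtype.ext ((hGb t y hy).trans
             (congrArg Subtype.val (p.2 y hy)).symm) }⟩

section IndependenceComplex

variable {V : Type*} {r : V → V → Prop}

/-- The geometric realization of the complex of those subsets of `S` whose distinct members are
pairwise not in conflict, where `r` is the conflict relation. -/
def indepRealization [Fintype V] (r : V → V → Prop) (S : Finset V) : Set (V → ℝ) :=
  {w | w ∈ stdSimplex ℝ V ∧ (∀ v, w v ≠ 0 → v ∈ S) ∧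
    ∀ u v, w u ≠ 0 → w v ≠ 0 → u ≠ v → ¬ r u v}

theorem indepRealization_of_support [Fintype V] {S : Finset V} {w w' : V → ℝ}
    (hw : w ∈ indepRealization r S) (hw' : w' ∈ stdSimplex ℝ V)
    (h : ∀ v, w' v ≠ 0 → w v ≠ 0) : w' ∈ indepRealization r S :=
  ⟨hw', fun v hv => hw.2.1 v (h v hv), fun u v hu hv => hw.2.2 u v (h u hu) (h v hv)⟩

theorem segment_subset_indepRealization [Fintype V] {S : Finset V} {w w' : V → ℝ}
    (hw : w ∈ indepRealization r S) (hw' : w' ∈ stdSimplex ℝ V)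
    (h : ∀ v, w' v ≠ 0 → w v ≠ 0) : segment ℝ w w' ⊆ indepRealization r S := fun x hx => by
  refine indepRealization_of_support hw ((convex_stdSimplex ℝ V).segment_subset hw.1 hw' hx)
    fun v hv h0 => hv ?_
  obtain ⟨a, b, -, -, -, rfl⟩ := hx
  have : w' v = 0 := by
    by_contra hne
    exact h v hne h0
  simp [h0, this]

variable [DecidableEq V]

theorem single_mem_indepRealization [Fintype V] {S : Finset V} {v : V} (hv : v ∈ S) :
    Pi.single v (1 : ℝ) ∈ indepRealization r S := by
  have key : ∀ u, (Pi.single v (1 : ℝ) : V → ℝ) u ≠ 0 → u = v := fun u hu => by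
    by_contra hne
    exact hu (Pi.single_eq_of_ne hne _)
  refine ⟨single_mem_stdSimplex ℝ v, fun u hu => key u hu ▸ hv, fun u u' hu hu' hne => ?_⟩
  exact absurd ((key u hu).trans (key u' hu').symm) hne

theorem sphereExt_zero {W : Type*} [TopologicalSpace W] {Y : Set W} (h : Y.Nonempty) :
    SphereExt 0 Y := by
  obtain ⟨y, hy⟩ := h
  refine ⟨⟨y, hy⟩, fun d hd f _ _ => ?_⟩
  obtain rfl : d = 0 := Nat.le_zero.1 hd
  exact ⟨fun _ => y, continuousOn_const, fun _ _ => hy, fun u hu =>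
    (mem_sphere_pi.1 hu).2.elim fun i _ => i.elim0⟩

/-- A complex is a cone over each vertex that is in conflict with no other vertex. -/
theorem sphereExt_of_isolated [Fintype V] {N : ℕ} {S : Finset V} {v : V} (hv : v ∈ S) (hr : ∀ ⦃u v⦄, r u v → r v u)
    (hiso : ∀ u ∈ S, u ≠ v → ¬ r v u) : SphereExt N (indepRealization r S) := by
  refine SphereExt.of_starConvex (single_mem_indepRealization hv) fun w hw x hx => ?_
  refine ⟨(convex_stdSimplex ℝ V).segment_subset hw.1 (single_mem_stdSimplex ℝ v) hx, ?_⟩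
  have key : ∀ u, x u ≠ 0 → u = v ∨ w u ≠ 0 := fun u hu => by
    by_contra! hne
    obtain ⟨a, b, -, -, -, rfl⟩ := hx
    simp [hne.1, hne.2] at hu
  have memS : ∀ u, x u ≠ 0 → u ∈ S := fun u hu => by
    rcases key u hu with rfl | h
    exacts [hv, hw.2.1 u h]
  refine ⟨memS, fun u u' hu hu' hne hrel => ?_⟩
  rcases eq_or_ne u v with rfl | huv
  · exact hiso u' (memS u' hu') hne.symm hrel
  · rcases eq_or_ne u' v with rfl | hu'v
    · exact hiso u (memS u hu) hne (hr hrel)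
    · exact hw.2.2 u u' ((key u hu).resolve_left huv) ((key u' hu').resolve_left hu'v) hne hrel

/-- Projection away from the vertex `v`. -/
noncomputable def removeVertex (v : V) (w : V → ℝ) : V → ℝ :=
  (1 - w v)⁻¹ • Function.update w v 0

theorem removeVertex_mem_stdSimplex [Fintype V] {v : V} {w : V → ℝ} (hw : w ∈ stdSimplex ℝ V)
    (hv : w v < 1) : removeVertex v w ∈ stdSimplex ℝ V := by
  have h1 : 0 < 1 - w v := sub_pos.2 hv
  refine ⟨fun u => mul_nonneg (inv_nonneg.2 h1.le) ?_, ?_⟩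
  · rcases eq_or_ne u v with rfl | h
    · simp
    · simpa [h] using hw.1 u
  · simp only [removeVertex, Pi.smul_apply, smul_eq_mul, ← Finset.mul_sum]
    rw [Finset.sum_update_of_mem (Finset.mem_univ v), zero_add]
    have h2 := Finset.sum_sdiff (f := w) (Finset.subset_univ {v})
    rw [Finset.sum_singleton, hw.2] at h2
    rw [eq_sub_of_add_eq h2, inv_mul_cancel₀ h1.ne']

theorem removeVertex_ne_zero {v u : V} {w : V → ℝ} (h : removeVertex v w u ≠ 0) :
    u ≠ v ∧ w u ≠ 0 := by
  have huv : u ≠ v := by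
    rintro rfl
    simp [removeVertex] at h
  refine ⟨huv, fun h0 => h ?_⟩
  simp [removeVertex, huv, h0]

theorem continuousOn_removeVertex [Fintype V] (v : V) (X : Set (V → ℝ)) :
    ContinuousOn (removeVertex v) (X ∩ {w | w v < 1}) := by
  have h : ContinuousOn (fun w : V → ℝ => (1 - w v)⁻¹) (X ∩ {w | w v < 1}) :=
    ContinuousOn.inv₀ (by fun_prop) fun w hw => (sub_pos.2 hw.2).ne'
  exact h.smul (continuous_id.update v continuous_const).continuousOn

open Classical in
/-- If the complex without the vertex `v` is `N`-connected and the link of `v` is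
`(N - 1)`-connected, then the complex is `N`-connected. -/
theorem sphereExt_of_erase [Fintype V] {N : ℕ} {S : Finset V} {v : V} (hv : v ∈ S) (hr : ∀ ⦃u v⦄, r u v → r v u)
    (herase : SphereExt (N + 1) (indepRealization r (S.erase v)))
    (hlink : SphereExt N (indepRealization r (S.filter fun u => u ≠ v ∧ ¬ r v u))) :
    SphereExt (N + 1) (indepRealization r S) := by
  set X := indepRealization r S with hX
  set e : V → ℝ := Pi.single v 1 with he
  have hev : e v = 1 := by simp [he]
  have heu : ∀ u, e u ≠ 0 → u = v := fun u hu => by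
    by_contra hne
    exact hu (Pi.single_eq_of_ne hne _)
  have hes : e ∈ stdSimplex ℝ V := single_mem_stdSimplex ℝ v
  refine SphereExt.union_isOpen (O₁ := {w | w v < 1}) (O₂ := {w | 0 < w v})
    (isOpen_lt (continuous_apply v) continuous_const)
    (isOpen_lt continuous_const (continuous_apply v)) (fun w _ => ?_) ?_ ?_ ?_
  · rcases lt_or_ge 0 (w v) with h | h
    exacts [Or.inr h, Or.inl (h.trans_lt one_pos)]
  · refine herase.of_segment (r := removeVertex v) (i := id) (continuousOn_removeVertex v X) ?_
      continuousOn_id ?_ ?_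
    · rintro w ⟨hw, hwv⟩
      refine ⟨removeVertex_mem_stdSimplex hw.1 hwv, fun u hu => ?_, fun u u' hu hu' => ?_⟩
      · exact Finset.mem_erase.2 ⟨(removeVertex_ne_zero hu).1, hw.2.1 u (removeVertex_ne_zero hu).2⟩
      · exact hw.2.2 u u' (removeVertex_ne_zero hu).2 (removeVertex_ne_zero hu').2
    · intro w hw
      refine ⟨⟨hw.1, fun u hu => Finset.mem_of_mem_erase (hw.2.1 u hu), hw.2.2⟩, ?_⟩
      have : w v = 0 := by
        by_contra hne
        exact Finset.notMem_erase v S (hw.2.1 v hne)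
      simp [this]
    · rintro w ⟨hw, hwv⟩
      refine subset_inter (segment_subset_indepRealization hw
        (removeVertex_mem_stdSimplex hw.1 hwv) fun u hu => (removeVertex_ne_zero hu).2) ?_
      refine (convex_halfSpace_lt (LinearMap.isLinear (LinearMap.proj v)) 1).segment_subset hwv ?_
      simp [removeVertex]
  · refine SphereExt.of_starConvex (y := e) ⟨single_mem_indepRealization hv, by simp [hev]⟩ ?_
    rintro w ⟨hw, hwv⟩
    refine subset_inter (segment_subset_indepRealization hw hes fun u hu => ?_) ?_
    · rw [heu u hu]; exact ne_of_gt hwv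
    · refine (convex_halfSpace_gt (LinearMap.isLinear (LinearMap.proj v)) 0).segment_subset hwv ?_
      simp [hev]
  · set i : (V → ℝ) → V → ℝ := fun u => (1 / 2 : ℝ) • u + (1 / 2 : ℝ) • e with hi
    have his : ∀ w ∈ stdSimplex ℝ V, i w ∈ stdSimplex ℝ V := fun w hw =>
      convex_stdSimplex ℝ V hw hes (by norm_num) (by norm_num) (by norm_num)
    have hisupp : ∀ w u, i w u ≠ 0 → u = v ∨ w u ≠ 0 := fun w u hu => by
      by_contra! h
      have : e u = 0 := Pi.single_eq_of_ne h.1 _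
      simp [hi, h.2, this] at hu
    have hiv : ∀ w : V → ℝ, w v = 0 → i w v = 1 / 2 := fun w hw => by simp [hi, hw, hev]
    have hrem : ∀ w : V → ℝ, removeVertex v w v = 0 := fun w => by simp [removeVertex]
    refine hlink.of_segment (r := removeVertex v) (i := i)
      ((continuousOn_removeVertex v X).mono fun w hw => ⟨hw.1, hw.2.1⟩) ?_
      (Continuous.continuousOn (by fun_prop)) ?_ ?_
    · rintro w ⟨hw, hw1, hw0⟩
      refine ⟨removeVertex_mem_stdSimplex hw.1 hw1, fun u hu => ?_, fun u u' hu hu' => ?_⟩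
      · obtain ⟨h1, h2⟩ := removeVertex_ne_zero hu
        exact Finset.mem_filter.2 ⟨hw.2.1 u h2, h1, hw.2.2 v u (ne_of_gt hw0) h2 h1.symm⟩
      · exact hw.2.2 u u' (removeVertex_ne_zero hu).2 (removeVertex_ne_zero hu').2
    · intro w hw
      have hwv : w v = 0 := by
        by_contra hne
        exact (Finset.mem_filter.1 (hw.2.1 v hne)).2.1 rfl
      refine ⟨⟨his w hw.1, fun u hu => ?_, fun u u' hu hu' hne hrel => ?_⟩, ?_, ?_⟩
      · rcases hisupp w u hu with rfl | h
        exacts [hv, (Finset.mem_filter.1 (hw.2.1 u h)).1]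
      · rcases hisupp w u hu with rfl | h
        · rcases hisupp w u' hu' with rfl | h'
          · exact hne rfl
          · exact (Finset.mem_filter.1 (hw.2.1 u' h')).2.2 hrel
        · rcases hisupp w u' hu' with rfl | h'
          · exact (Finset.mem_filter.1 (hw.2.1 u h)).2.2 (hr hrel)
          · exact hw.2.2 u u' h h' hne hrel
      · change i w v < 1
        rw [hiv w hwv]; norm_num
      · change 0 < i w v
        rw [hiv w hwv]; norm_num
    · rintro w ⟨hw, hw1, hw0⟩
      refine subset_inter (segment_subset_indepRealization hw
        (his _ (removeVertex_mem_stdSimplex hw.1 hw1)) fun u hu => ?_) (subset_inter ?_ ?_)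
      · rcases hisupp _ u hu with rfl | h
        exacts [ne_of_gt hw0, (removeVertex_ne_zero h).2]
      · refine (convex_halfSpace_lt (LinearMap.isLinear (LinearMap.proj v)) 1).segment_subset hw1 ?_
        change i (removeVertex v w) v < 1
        rw [hiv _ (hrem w)]; norm_num
      · refine (convex_halfSpace_gt (LinearMap.isLinear (LinearMap.proj v)) 0).segment_subset hw0 ?_
        change 0 < i (removeVertex v w) v
        rw [hiv _ (hrem w)]; norm_num

open Classical in
/-- Deletion of several vertices, in an arbitrary order. -/
theorem sphereExt_of_sdiff [Fintype V] {N : ℕ} {S D : Finset V} (hr : ∀ ⦃u v⦄, r u v → r v u) (hD : D ⊆ S)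
    (hlink : ∀ S', S \ D ⊆ S' → S' ⊆ S → ∀ v ∈ D,
      SphereExt N (indepRealization r (S'.filter fun u => u ≠ v ∧ ¬ r v u)))
    (h : SphereExt (N + 1) (indepRealization r (S \ D))) :
    SphereExt (N + 1) (indepRealization r S) := by
  have key : ∀ D' ⊆ D, SphereExt (N + 1) (indepRealization r (S \ D ∪ D')) := by
    intro D'
    induction D' using Finset.induction_on with
    | empty => intro _; simpa using h
    | insert v D' hvD' ih =>
      intro hsub
      have hvD : v ∈ D := hsub (Finset.mem_insert_self v D')
      have herase : (S \ D ∪ insert v D').erase v = S \ D ∪ D' := by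
        ext u
        simp only [Finset.mem_erase, Finset.mem_union, Finset.mem_sdiff, Finset.mem_insert]
        grind
      refine sphereExt_of_erase (v := v) (by simp) hr ?_ ?_
      · rw [herase]; exact ih ((Finset.subset_insert _ _).trans hsub)
      · exact hlink _ Finset.subset_union_left
          (Finset.union_subset Finset.sdiff_subset (hsub.trans hD)) v hvD
  simpa [Finset.sdiff_union_of_subset hD] using key D subset_rfl

end IndependenceComplex

/-- Two triples are in conflict if they cannot be vertices of a common simplex. -/
def Conflict {k l : ℕ} (u v : vertexSet k l) : Prop :=
  u.1.1 = v.1.1 ∨ u.1.1 = v.1.2.1 ∨ u.1.2.1 = v.1.1 ∨ u.1.2.1 = v.1.2.1 ∨ u.1.2.2 = v.1.2.2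

theorem Conflict.symm {k l : ℕ} ⦃u v : vertexSet k l⦄ (h : Conflict u v) : Conflict v u := by
  unfold Conflict at *; omega

theorem mem_lkQV_iff {k l : ℕ} {S : Finset (vertexSet k l)} : S ∈ (lkQV k l).faces ↔
    S.Nonempty ∧ ∀ u ∈ S, ∀ v ∈ S, u ≠ v → ¬ Conflict u v := by
  have hx : (xCoords S).Nodup ↔ ∀ u ∈ S, ∀ v ∈ S, u ≠ v →
      Disjoint ({u.1.1, u.1.2.1} : Multiset ℕ) {v.1.1, v.1.2.1} := by
    rw [xCoords, Multiset.nodup_bind]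
    constructor
    · rintro ⟨-, h⟩ u hu v hv huv
      have : Std.Symm (Function.onFun Disjoint
          fun v : vertexSet k l => ({v.1.1, v.1.2.1} : Multiset ℕ)) := ⟨fun _ _ h => Disjoint.symm h⟩
      exact Multiset.Pairwise.forall h hu hv huv
    · intro h
      refine ⟨fun v _ => ?_, Multiset.Nodup.pairwise h S.nodup⟩
      have := (Finset.mem_filter.1 v.2).2
      simpa using this
  have ha : (aCoords S).Nodup ↔ ∀ u ∈ S, ∀ v ∈ S, u ≠ v → u.1.2.2 ≠ v.1.2.2 := by
    rw [aCoords, Multiset.nodup_map_iff_inj_on S.nodup]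
    exact forall₂_congr fun u _ => forall₂_congr fun v _ => not_imp_not.symm
  change S.Nonempty ∧ (xCoords S).Nodup ∧ (aCoords S).Nodup ↔ _
  rw [hx, ha]
  refine and_congr_right fun _ => ?_
  simp only [← forall_and]
  refine forall₂_congr fun u _ => forall₂_congr fun v _ => forall_congr' fun _ => ?_
  simp only [Conflict, Multiset.disjoint_left, Multiset.insert_eq_cons, Multiset.mem_cons,
    Multiset.mem_singleton]
  constructor
  · rintro ⟨h1, h2⟩ h3
    have h4 := h1 (Or.inl rfl)
    have h5 := h1 (Or.inr rfl)
    omega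
  · intro h
    refine ⟨fun {a} h1 h2 => ?_, ?_⟩ <;> omega

open Classical in
theorem realization_spannedSubcomplex {k l : ℕ} (W : Set (vertexSet k l)) :
    realization (spannedSubcomplex (lkQV k l) W) =
      indepRealization Conflict (Finset.univ.filter (· ∈ W)) := by
  ext w
  constructor
  · rintro ⟨hw, s, ⟨hs, hsW⟩, hs0⟩
    have hs' : ∀ v, w v ≠ 0 → v ∈ s := fun v hv => by
      by_contra hvs
      exact hv (hs0 v hvs)
    exact ⟨hw, fun v hv => by simpa using hsW v (hs' v hv),
      fun u v hu hv => (mem_lkQV_iff.1 hs).2 u (hs' u hu) v (hs' v hv)⟩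
  · rintro ⟨hw, hwW, hwc⟩
    refine ⟨hw, Finset.univ.filter fun v => w v ≠ 0, ⟨mem_lkQV_iff.2 ⟨?_, ?_⟩, ?_⟩, ?_⟩
    · by_contra hne
      have h0 : ∀ v, w v = 0 := by simpa [Finset.not_nonempty_iff_eq_empty,
        Finset.filter_eq_empty_iff] using hne
      have := hw.2
      simp [h0] at this
    · intro u hu v hv
      exact hwc u v (Finset.mem_filter.1 hu).2 (Finset.mem_filter.1 hv).2
    · intro v hv
      exact (Finset.mem_filter.1 (hwW v (Finset.mem_filter.1 hv).2)).2
    · intro v hv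
      simpa using hv

/-- The set `S` contains all vertices `(e, e + 1, p)` with
`e ∈ E` and `p ∈ C`. -/
def ContainsGrid {k l : ℕ} (S : Finset (vertexSet k l)) (E C : Finset ℕ) : Prop :=
  ∀ e ∈ E, ∀ p ∈ C, ∀ v : vertexSet k l, v.1 = (e, e + 1, p) → v ∈ S

theorem card_sdiff_triple (E : Finset ℕ) (a b c : ℕ) : E.card ≤ (E \ {a, b, c}).card + 3 := by
  have h1 := Finset.le_card_sdiff {a, b, c} E
  have h2 : ({a, b, c} : Finset ℕ).card ≤ 3 := Finset.card_le_three
  omega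

/-- An edge of the cycle on `{1, …, k}` meets at most three edges of the path. -/
theorem exists_triple {k l : ℕ} {E : Finset ℕ} (hE : E ⊆ Finset.Icc 1 (k - 1))
    (v : vertexSet k l) (hv : v.1.2.1 = v.1.1 + 1 ∨ v.1.1 = k ∧ v.1.2.1 = 1) :
    ∃ a b c, ∀ e ∈ E \ {a, b, c},
      e ≠ v.1.1 ∧ e ≠ v.1.2.1 ∧ e + 1 ≠ v.1.1 ∧ e + 1 ≠ v.1.2.1 := by
  refine ⟨v.1.1 - 1, v.1.1, v.1.2.1, fun e he => ?_⟩
  obtain ⟨h1, h2⟩ := Finset.mem_sdiff.1 he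
  have h3 := Finset.mem_Icc.1 (hE h1)
  simp only [Finset.mem_insert, Finset.mem_singleton] at h2
  omega

/-- If an edge of the cycle meets the first edge `e₀` of a subset `E` of the path, then the two
edges together meet at most three members of `E`. -/
theorem exists_triple_of_adj {k l : ℕ} {E : Finset ℕ} (hE : E ⊆ Finset.Icc 1 (k - 1)) {e₀ : ℕ}
    (he₀ : e₀ ∈ E) (hmin : ∀ e ∈ E, e₀ ≤ e) (v : vertexSet k l)
    (hv : v.1.2.1 = v.1.1 + 1 ∨ v.1.1 = k ∧ v.1.2.1 = 1)
    (hadj : e₀ = v.1.1 ∨ e₀ = v.1.2.1 ∨ e₀ + 1 = v.1.1 ∨ e₀ + 1 = v.1.2.1) :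
    ∃ a b c, ∀ e ∈ E \ {a, b, c},
      (e ≠ v.1.1 ∧ e ≠ v.1.2.1 ∧ e + 1 ≠ v.1.1 ∧ e + 1 ≠ v.1.2.1) ∧ e₀ + 1 < e := by
  have h0 := Finset.mem_Icc.1 (hE he₀)
  rcases hv with hv | hv
  · refine ⟨e₀, e₀ + 1, e₀ + 2, fun e he => ?_⟩
    obtain ⟨h1, h2⟩ := Finset.mem_sdiff.1 he
    have h3 := hmin e h1
    simp only [Finset.mem_insert, Finset.mem_singleton] at h2
    omega
  · refine ⟨e₀, e₀ + 1, k - 1, fun e he => ?_⟩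
    obtain ⟨h1, h2⟩ := Finset.mem_sdiff.1 he
    have h3 := hmin e h1
    have h4 := Finset.mem_Icc.1 (hE h1)
    simp only [Finset.mem_insert, Finset.mem_singleton] at h2
    omega

open Classical in
/-- The complex on a set of vertices which contains a sufficiently large grid is highly
connected. -/
theorem sphereExt_of_containsGrid {k l : ℕ} (N : ℕ) : ∀ (S : Finset (vertexSet k l))
    (E C : Finset ℕ), (∀ v ∈ S, v.1.2.1 = v.1.1 + 1 ∨ v.1.1 = k ∧ v.1.2.1 = 1) →
    E ⊆ Finset.Icc 1 (k - 1) → C ⊆ Finset.Icc 1 l → 3 * N + 1 ≤ E.card → 2 * N + 1 ≤ C.card →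
    ContainsGrid S E C → SphereExt N (indepRealization Conflict S) := by
  have hmem : ∀ {E C : Finset ℕ}, E ⊆ Finset.Icc 1 (k - 1) → C ⊆ Finset.Icc 1 l → ∀ e ∈ E,
      ∀ p ∈ C, (e, e + 1, p) ∈ vertexSet k l := by
    intro E C hE hC e he p hp
    have h1 := Finset.mem_Icc.1 (hE he)
    have h2 := Finset.mem_Icc.1 (hC hp)
    simp only [vertexSet, Finset.mem_filter, Finset.mem_product, Finset.mem_Icc]
    omega
  induction N with
  | zero =>
    intro S E C _ hE hC hEc hCc hgrid
    obtain ⟨e, he⟩ := Finset.card_pos.1 (by omega : 0 < E.card)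
    obtain ⟨p, hp⟩ := Finset.card_pos.1 (by omega : 0 < C.card)
    exact sphereExt_zero ⟨_, single_mem_indepRealization
      (hgrid e he p hp ⟨_, hmem hE hC e he p hp⟩ rfl)⟩
  | succ N ih =>
    intro S E C hS hE hC hEc hCc hgrid
    have hEne : E.Nonempty := Finset.card_pos.1 (by omega)
    obtain ⟨p₀, hp₀⟩ := Finset.card_pos.1 (by omega : 0 < C.card)
    set e₀ := E.min' hEne with he₀def
    have he₀ : e₀ ∈ E := E.min'_mem hEne
    have hmin : ∀ e ∈ E, e₀ ≤ e := fun e he => E.min'_le e he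
    set v₀ : vertexSet k l := ⟨(e₀, e₀ + 1, p₀), hmem hE hC e₀ he₀ p₀ hp₀⟩ with hv₀def
    have hv₀ : v₀ ∈ S := hgrid e₀ he₀ p₀ hp₀ v₀ rfl
    set D₁ := S.filter fun v => v.1.2.2 = p₀ ∧ v ≠ v₀ with hD₁
    set D₂ := (S \ D₁).filter fun v => Conflict v₀ v ∧ v ≠ v₀ with hD₂
    refine sphereExt_of_sdiff (D := D₁) Conflict.symm (Finset.filter_subset _ _) ?_
      (sphereExt_of_sdiff (D := D₂) Conflict.symm (Finset.filter_subset _ _) ?_ ?_)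
    · intro S' hS' hS'S v hv
      obtain ⟨hvS, hvp, -⟩ := Finset.mem_filter.1 hv
      obtain ⟨a, b, c, habc⟩ := exists_triple hE v (hS v hvS)
      have hc1 := card_sdiff_triple E a b c
      have hc2 := Finset.card_erase_of_mem hp₀
      refine ih _ (E \ {a, b, c}) (C.erase p₀)
        (fun u hu => hS u (hS'S (Finset.mem_filter.1 hu).1)) (Finset.sdiff_subset.trans hE)
        ((Finset.erase_subset _ _).trans hC) (by omega) (by omega) ?_
      intro e he p hp u hu
      obtain ⟨hpp₀, hpC⟩ := Finset.mem_erase.1 hp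
      have hup : u.1.2.2 = p := by rw [hu]
      have huS : u ∈ S := hgrid e (Finset.mem_sdiff.1 he).1 p hpC u hu
      have h1 := habc e he
      have hconf : ¬ Conflict v u := by
        simp only [Conflict, hu]
        omega
      refine Finset.mem_filter.2 ⟨hS' (Finset.mem_sdiff.2 ⟨huS, fun h => ?_⟩), ?_, hconf⟩
      · exact hpp₀ (hup.symm.trans (Finset.mem_filter.1 h).2.1)
      · rintro rfl; exact hconf (Or.inl rfl)
    · intro S' hS' hS'S v hv
      obtain ⟨hvS, hvc, hvne⟩ := Finset.mem_filter.1 hv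
      obtain ⟨hvS, hvD⟩ := Finset.mem_sdiff.1 hvS
      have hvp : v.1.2.2 ≠ p₀ := fun h => hvD (Finset.mem_filter.2 ⟨hvS, h, hvne⟩)
      obtain ⟨a, b, c, habc⟩ := exists_triple_of_adj hE he₀ hmin v (hS v hvS) (by
        simp only [Conflict, hv₀def] at hvc; omega)
      have hc1 := card_sdiff_triple E a b c
      have hc2 := Finset.card_erase_of_mem hp₀
      have hc3 := Finset.pred_card_le_card_erase (s := C.erase p₀) (a := v.1.2.2)
      refine ih _ (E \ {a, b, c}) ((C.erase p₀).erase v.1.2.2)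
        (fun u hu => hS u (Finset.mem_sdiff.1 (hS'S (Finset.mem_filter.1 hu).1)).1)
        (Finset.sdiff_subset.trans hE)
        ((Finset.erase_subset _ _).trans ((Finset.erase_subset _ _).trans hC)) (by omega)
        (by omega) ?_
      intro e he p hp u hu
      obtain ⟨hpv, hp⟩ := Finset.mem_erase.1 hp
      obtain ⟨hpp₀, hpC⟩ := Finset.mem_erase.1 hp
      have hup : u.1.2.2 = p := by rw [hu]
      have huS : u ∈ S := hgrid e (Finset.mem_sdiff.1 he).1 p hpC u hu
      have h1 := habc e he
      have hconf : ¬ Conflict v u := by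
        simp only [Conflict, hu]
        omega
      have hconf₀ : ¬ Conflict v₀ u := by
        simp only [Conflict, hu, hv₀def]
        omega
      refine Finset.mem_filter.2 ⟨hS' (Finset.mem_sdiff.2 ⟨Finset.mem_sdiff.2
        ⟨huS, fun h => ?_⟩, fun h => ?_⟩), ?_, hconf⟩
      · exact hpp₀ (hup.symm.trans (Finset.mem_filter.1 h).2.1)
      · exact hconf₀ (Finset.mem_filter.1 h).2.1
      · rintro rfl; exact hconf (Or.inl rfl)
    · refine sphereExt_of_isolated (v := v₀) ?_ Conflict.symm fun u hu hne hconf => ?_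
      · simp [hD₁, hD₂, hv₀]
      · obtain ⟨h1, h2⟩ := Finset.mem_sdiff.1 hu
        exact h2 (Finset.mem_filter.2 ⟨h1, hconf, hne⟩)

theorem isNConnected_spannedSubcomplex {n k l : ℕ} (hk : 3 * n + 5 ≤ k) (hl : 2 * n + 3 ≤ l)
    {W : Set (vertexSet k l)} (hpath : ∀ v : vertexSet k l, v.1.2.1 = v.1.1 + 1 → v ∈ W)
    (hcycle : ∀ v ∈ W, v.1.2.1 = v.1.1 + 1 ∨ v.1.1 = k ∧ v.1.2.1 = 1) :
    IsNConnected n (realization (spannedSubcomplex (lkQV k l) W)) := by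
  classical
  rw [realization_spannedSubcomplex]
  refine SphereExt.isNConnected (sphereExt_of_containsGrid (n + 1) _ (Finset.Icc 1 (k - 1))
    (Finset.Icc 1 l) (fun v hv => hcycle v (Finset.mem_filter.1 hv).2) subset_rfl subset_rfl
    (by rw [Nat.card_Icc]; omega) (by rw [Nat.card_Icc]; omega) ?_)
  intro e _ p _ v hv
  exact Finset.mem_filter.2 ⟨Finset.mem_univ v, hpath v (by rw [hv])⟩

end DescendingLinks

theorem mainTheorem5 (n k l : ℕ) (hk : 3 * n + 5 ≤ k) (hl : 2 * n + 3 ≤ l) :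
    DescendingLinks.IsNConnected n (DescendingLinks.realization (DescendingLinks.lkQF k l)) ∧
    DescendingLinks.IsNConnected n (DescendingLinks.realization (DescendingLinks.lkQT k l)) :=
  ⟨DescendingLinks.isNConnected_spannedSubcomplex hk hl (fun _ h => h) (fun _ h => Or.inl h),
    DescendingLinks.isNConnected_spannedSubcomplex hk hl (fun _ h => Or.inl h) (fun _ h => h)⟩
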